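/- Identify the unit circle $\mathbb T$ with $\mathbb R/\mathbb Z$ via $\theta\mapsto e^{2\pi i\theta}$ and let $m$ be the normalized Lebesgue measure on $\mathbb T$. For a finite positive Borel measure $\rho$ on $\mathbb T$ and $n\ge 0$ put $$e_n(\rho)=\min_{q_0,\dots,q_{n-1}\in\mathbb C}\Bigl(\int_{\mathbb T}|q_0+q_1t+\dots+q_{n-1}t^{n-1}+t^n|^2\,d\rho(t)\Bigr)^{1/2},$$ with $|\log e_n(\rho)|=+\infty$ if $e_n(\rho)=0$. For a measurable $H\colon\mathbb T\to[0,+\infty]$ let $\lambda_H(a)=m\{H>a\}$. Let $\phi\colon[0,\frac12]\to(0,+\infty]$ be continuous and (strictly) decreasing with $\phi(0)=+\infty$. A function $H$ is subordinated to $\phi$ if $\phi(\frac12)\le\inf_{\mathbb T}H$ and, for every $\tau\in[-\frac12,\frac12]$, with $\theta_\tau\in[0,\frac12]$ the solution of $\phi(\theta_\tau)=H(e^{2\pi i\tau})$, $$H(e^{2\pi i\theta})\le\phi(\theta+\theta_\tau-\tau)\quad(\tau-\theta_\tau<\theta\le\tau),\qquad H(e^{2\pi i\theta})\le\phi(\tau+\theta_\tau-\theta)\quad(\tau\le\theta<\tau+\theta_\tau).$$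 For a constant $C>0$ consider the following regularity conditions on $\phi$, each required for all $\theta\in(0,\frac12]$: (Reg1) the function $\theta\mapsto\theta\phi(\theta)$ does not decrease on $(0,\frac12]$, and $\log\frac1\theta\le C\phi(\theta)$; (Reg2) $\phi(\theta/2)\le C\phi(\theta)$ and $\frac1\theta\le C\phi(\theta)$. Theorem. For every $C>0$ there is $c>0$, depending only on $C$, such that the following holds. Let $\phi$ be as above, let $H\colon\mathbb T\to[0,+\infty]$ be measurable and subordinated to $\phi$ with $\int_{\mathbb T}H\,dm=+\infty$, and let $\rho$ be a finite positive Borel measure on $\mathbb T$ with $\int_{\mathbb T}e^H\,d\rho<\infty$. (a) If $\phi$ satisfies (Reg1) with constant $C$, then for all sufficiently large $n$ the equation $n\phi^{-1}(A)=A$ has a unique solution $A=A(n)$, and $$|\log e_n(\rho)|\ge c\int_0^{A}\lambda_H(a)\,da .$$ (b) If $\phi$ satisfies (Reg2) with constant $C$, then for all sufficiently large $n$ the same inequality holds with $A=\sqrt n$. How large $n$ must be may depend on $\phi$, $H$ and $\rho$. -/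

import Mathlib

open Set Filter MeasureTheory
open scoped ENNReal

namespace SzegoMinimum

/-! The unit circle `𝕋` is identified with `ℝ / ℤ` (`UnitAddCircle`) through `θ ↦ e^{2πiθ}`
(`AddCircle.toCircle`); the normalized Lebesgue measure `m` is then `volume`. -/

/-- The quantity `e_n(ρ)`: the minimum over `q_0, …, q_{n-1} ∈ ℂ` of
`(∫_𝕋 |q_0 + q_1 t + ⋯ + q_{n-1} t^{n-1} + t^n|² dρ(t))^{1/2}`. -/
noncomputable def szegoError (ρ : Measure UnitAddCircle) (n : ℕ) : ℝ :=
  ⨅ q : Fin n → ℂ, Real.sqrt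
    (∫ x : UnitAddCircle,
      ‖(∑ k : Fin n, q k * (AddCircle.toCircle x : ℂ) ^ (k : ℕ))
        + (AddCircle.toCircle x : ℂ) ^ n‖ ^ 2 ∂ρ)

/-- `|log e_n(ρ)|` as an element of `[0, ∞]`; it is `∞` when `e_n(ρ) = 0`. -/
noncomputable def absLogSzegoError (ρ : Measure UnitAddCircle) (n : ℕ) : ℝ≥0∞ :=
  (ENNReal.log (ENNReal.ofReal (szegoError ρ n))).abs

/-- The distribution function `λ_H(a) = m{H > a}`. -/
noncomputable def distribution (H : UnitAddCircle → ℝ≥0∞) (a : ℝ) : ℝ≥0∞ :=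
  volume {x : UnitAddCircle | ENNReal.ofReal a < H x}

/-- `φ : [0, 1/2] → (0, ∞]` is continuous and decreasing with `φ(0) = ∞`
(values of `φ` outside `[0, 1/2]` play no role). -/
structure IsProfile (φ : ℝ → ℝ≥0∞) : Prop where
  continuousOn : ContinuousOn φ (Icc 0 (1 / 2))
  strictAntiOn : StrictAntiOn φ (Icc 0 (1 / 2))
  map_zero : φ 0 = ∞
  pos : ∀ θ ∈ Icc (0 : ℝ) (1 / 2), 0 < φ θ

/-- `H` is subordinated to the profile `φ`: `φ(1/2) ≤ inf H` and, for every `τ`, with `s = θ_τ`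
the solution in `[0, 1/2]` of `φ(s) = H(e^{2πiτ})`, the function `H` is bounded by `φ` as stated
on both sides of `τ`. -/
structure IsSubordinate (H : UnitAddCircle → ℝ≥0∞) (φ : ℝ → ℝ≥0∞) : Prop where
  le_inf : φ (1 / 2) ≤ ⨅ x, H x
  left : ∀ τ ∈ Icc (-(1 / 2) : ℝ) (1 / 2), ∀ s ∈ Icc (0 : ℝ) (1 / 2),
    φ s = H (τ : UnitAddCircle) →
      ∀ θ : ℝ, τ - s < θ → θ ≤ τ → H (θ : UnitAddCircle) ≤ φ (θ + s - τ)
  right : ∀ τ ∈ Icc (-(1 / 2) : ℝ) (1 / 2), ∀ s ∈ Icc (0 : ℝ) (1 / 2),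
    φ s = H (τ : UnitAddCircle) →
      ∀ θ : ℝ, τ ≤ θ → θ < τ + s → H (θ : UnitAddCircle) ≤ φ (τ + s - θ)

/-- First regularity condition, with constant `C`: `θ ↦ θ φ(θ)` does not decrease on `(0, 1/2]`
and `log (1/θ) ≤ C φ(θ)` there. -/
structure Reg1 (C : ℝ) (φ : ℝ → ℝ≥0∞) : Prop where
  mono : MonotoneOn (fun θ : ℝ => ENNReal.ofReal θ * φ θ) (Ioc 0 (1 / 2))
  log_le : ∀ θ ∈ Ioc (0 : ℝ) (1 / 2),
    ENNReal.ofReal (Real.log (1 / θ)) ≤ ENNReal.ofReal C * φ θ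

/-- Second regularity condition, with constant `C`: `φ(θ/2) ≤ C φ(θ)` and `1/θ ≤ C φ(θ)`
on `(0, 1/2]`. -/
structure Reg2 (C : ℝ) (φ : ℝ → ℝ≥0∞) : Prop where
  doubling : ∀ θ ∈ Ioc (0 : ℝ) (1 / 2), φ (θ / 2) ≤ ENNReal.ofReal C * φ θ
  inv_le : ∀ θ ∈ Ioc (0 : ℝ) (1 / 2),
    ENNReal.ofReal (1 / θ) ≤ ENNReal.ofReal C * φ θ

/-- `A` solves the equation `n φ⁻¹(A) = A`: the number `s = φ⁻¹(A)`, that is the point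
`s ∈ [0, 1/2]` with `φ(s) = A`, exists and satisfies `n s = A`. -/
def SolvesLevelEquation (φ : ℝ → ℝ≥0∞) (n : ℕ) (A : ℝ) : Prop :=
  0 ≤ A ∧ ∃ s ∈ Icc (0 : ℝ) (1 / 2), φ s = ENNReal.ofReal A ∧ (n : ℝ) * s = A

end SzegoMinimum

/-!
Put `h = min (H, A)`. For a small constant `ε` let `F` be the outer function in the unit disc with
boundary modulus `exp (ε h)`, so that `F 0 = exp (ε ∫ h)` and `|F w| = exp (ε P[h](w))`, where `P`
is the Poisson integral. Let `t` be `φ⁻¹(A)` in case (a) and `1 / A` in case (b), and let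
`r = 1 - (D + 1) t`, where `D` depends on `C` only. At a point `x` with `H x = φ(s)`, subordination
and doubling bound `H` by `D H x` within distance `s / 2` of `x`; the Poisson kernel at `r x` has
mass `O(t / s)` outside this arc, where `h ≤ A`, and `A t = O(s φ(s))` by the regularity of `φ`.
Hence `P[h](r x) ≤ K h x`, and with `ε = 1 / (2 K)` the function `F(r ·)` is at most `exp (h / 2)`
on the circle. Its Taylor polynomial `p` of degree `n` differs from it by at most `1`, because
`n t = A` and `log (1 / t) = O(A)`. Reversing the coefficients of `p` gives a competitor with
leading coefficient `conj (p 0)`, so `e_n(ρ) ≤ 2 (∫ e^H dρ)^{1/2} exp (-ε ∫ h)`. Finally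
`∫ h = ∫_0^A λ_H(a) da`, which tends to `∞` with `A`, so half of the exponent absorbs the constant.
-/

namespace SzegoMinimum

open Metric Real Polynomial
open scoped Topology

section Taylor

open scoped Nat

variable {F : Type*} [NormedAddCommGroup F] [NormedSpace ℂ F] [CompleteSpace F]
  {f : ℂ → F} {c w : ℂ} {R M : ℝ}

theorem norm_iteratedDeriv_le_of_forall_mem_ball_norm_le (k : ℕ) (hR : 0 < R)
    (hf : DifferentiableOn ℂ f (ball c R)) (hM : ∀ z ∈ ball c R, ‖f z‖ ≤ M) :
    ‖iteratedDeriv k f c‖ ≤ k ! * M / R ^ k := by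
  have hlim : Tendsto (fun r : ℝ => k ! * M / r ^ k) (𝓝[<] R) (𝓝 (k ! * M / R ^ k)) := by
    refine ContinuousAt.tendsto (f := fun r : ℝ => k ! * M / r ^ k) ?_ |>.mono_left
      nhdsWithin_le_nhds
    fun_prop (disch := positivity)
  refine ge_of_tendsto hlim ?_
  filter_upwards [Ioo_mem_nhdsLT hR] with r hr
  refine Complex.norm_iteratedDeriv_le_of_forall_mem_sphere_norm_le k hr.1 ?_
    fun z hz => hM z (sphere_subset_ball hr.2 hz)
  refine DifferentiableOn.diffContOnCl (hf.mono ?_)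
  rw [closure_ball _ hr.1.ne']
  exact closedBall_subset_ball hr.2

theorem norm_sub_sum_taylor_le (hf : DifferentiableOn ℂ f (ball c R))
    (hM : ∀ z ∈ ball c R, ‖f z‖ ≤ M) (hw : w ∈ ball c R) (N : ℕ) :
    ‖f w - ∑ k ∈ Finset.range N, (k ! : ℂ)⁻¹ • (w - c) ^ k • iteratedDeriv k f c‖
      ≤ M * (‖w - c‖ / R) ^ N / (1 - ‖w - c‖ / R) := by
  have hR : 0 < R := pos_of_mem_ball hw
  have hq : ‖w - c‖ / R < 1 := (div_lt_one hR).2 (mem_ball_iff_norm.1 hw)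
  have htail := (hasSum_nat_add_iff' N).2 (Complex.hasSum_taylorSeries_on_ball hf hw)
  have hgeom : HasSum (fun k : ℕ => M * (‖w - c‖ / R) ^ N * (‖w - c‖ / R) ^ k)
      (M * (‖w - c‖ / R) ^ N / (1 - ‖w - c‖ / R)) :=
    (hasSum_geometric_of_lt_one (by positivity) hq).mul_left _
  refine htail.norm_le_of_bounded hgeom fun k => ?_
  have hderiv := norm_iteratedDeriv_le_of_forall_mem_ball_norm_le (k + N) hR hf hM
  calc ‖((k + N)! : ℂ)⁻¹ • (w - c) ^ (k + N) • iteratedDeriv (k + N) f c‖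
      = ((k + N)! : ℝ)⁻¹ * (‖w - c‖ ^ (k + N) * ‖iteratedDeriv (k + N) f c‖) := by
        rw [norm_smul, norm_smul, norm_inv, norm_pow, Complex.norm_natCast]
    _ ≤ ((k + N)! : ℝ)⁻¹ * (‖w - c‖ ^ (k + N) * ((k + N)! * M / R ^ (k + N))) := by gcongr
    _ = M * (‖w - c‖ / R) ^ N * (‖w - c‖ / R) ^ k := by
        rw [mul_assoc, ← pow_add, add_comm N k, div_pow]; field_simp

theorem exists_polynomial_norm_sub_eval_le {f : ℂ → ℂ} (hf : DifferentiableOn ℂ f (ball c R))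
    (hM : ∀ z ∈ ball c R, ‖f z‖ ≤ M) (n : ℕ) :
    ∃ p : ℂ[X], p.natDegree ≤ n ∧ p.eval 0 = f c ∧ ∀ w ∈ ball c R,
      ‖f w - p.eval (w - c)‖ ≤ M * (‖w - c‖ / R) ^ (n + 1) / (1 - ‖w - c‖ / R) := by
  refine ⟨∑ k ∈ Finset.range (n + 1), monomial k ((k ! : ℂ)⁻¹ * iteratedDeriv k f c),
    natDegree_sum_le_of_forall_le _ _ fun k hk =>
      (natDegree_monomial_le _).trans (Finset.mem_range_succ_iff.1 hk), ?_, fun w hw => ?_⟩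
  · simp [eval_finsetSum, Finset.sum_range_succ']
  · have heval : ∑ k ∈ Finset.range (n + 1), (k ! : ℂ)⁻¹ • (w - c) ^ k • iteratedDeriv k f c =
        eval (w - c) (∑ k ∈ Finset.range (n + 1),
          monomial k ((k ! : ℂ)⁻¹ * iteratedDeriv k f c)) := by
      simp only [eval_finsetSum, eval_monomial, smul_eq_mul]
      exact Finset.sum_congr rfl fun k _ => by ring
    exact heval ▸ norm_sub_sum_taylor_le hf hM hw (n + 1)

end Taylor

section PoissonIntegral

variable {E : Type*} [NormedAddCommGroup E] {h : UnitAddCircle → ℝ} {w : ℂ}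

theorem coe_toCircle_coe (x : ℝ) :
    (AddCircle.toCircle (x : UnitAddCircle) : ℂ) = circleMap 0 1 (2 * π * x) := by
  rw [AddCircle.toCircle_apply_mk, Circle.coe_exp, circleMap]
  simp

theorem circleAverage_eq_integral_toCircle [NormedSpace ℝ E] (f : ℂ → E) :
    circleAverage f 0 1 = ∫ x : UnitAddCircle, f x.toCircle := by
  rw [← UnitAddCircle.intervalIntegral_preimage 0, circleAverage_def]
  simp only [coe_toCircle_coe, zero_add]
  rw [intervalIntegral.integral_comp_mul_left (fun t => f (circleMap 0 1 t)) two_pi_pos.ne']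
  simp

theorem circleIntegrable_of_integrable_toCircle {f : ℂ → E}
    (hf : Integrable fun x : UnitAddCircle => f x.toCircle) : CircleIntegrable f 0 1 := by
  have hpre := (UnitAddCircle.measurePreserving_mk 0).integrable_comp_of_integrable hf
  simp only [Function.comp_def, coe_toCircle_coe, zero_add] at hpre
  have hinterval : IntervalIntegrable (fun y : ℝ => f (circleMap 0 1 (2 * π * y))) volume 0 1 :=
    (intervalIntegrable_iff_integrableOn_Ioc_of_le zero_le_one).2 hpre
  have hscaled := hinterval.comp_mul_left (c := (2 * π)⁻¹)
  simp only [mul_inv_cancel_left₀ two_pi_pos.ne', zero_div, one_div, inv_inv] at hscaled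
  exact hscaled

theorem continuous_coe_toCircle : Continuous fun x : UnitAddCircle => (x.toCircle : ℂ) :=
  continuous_subtype_val.comp AddCircle.continuous_toCircle

theorem continuous_herglotzRieszKernel_toCircle (hw : w ∈ ball (0 : ℂ) 1) :
    Continuous fun x : UnitAddCircle => herglotzRieszKernel 0 w x.toCircle :=
  (continuousOn_herglotzRieszKernel_sphere hw).comp_continuous continuous_coe_toCircle
    fun x => by rw [mem_sphere_zero_iff_norm, Circle.norm_coe, abs_one]

theorem continuous_poissonKernel_toCircle (hw : w ∈ ball (0 : ℂ) 1) :
    Continuous fun x : UnitAddCircle => poissonKernel 0 w x.toCircle := by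
  rw [poissonKernel_eq_re_herglotzRieszKernel]
  exact Complex.continuous_re.comp (continuous_herglotzRieszKernel_toCircle hw)

theorem poissonKernel_toCircle_nonneg (hw : w ∈ ball (0 : ℂ) 1) (x : UnitAddCircle) :
    0 ≤ poissonKernel 0 w x.toCircle := by
  have hw' : ‖w‖ < 1 := mem_ball_zero_iff.1 hw
  rw [poissonKernel_def, sub_zero, sub_zero, Circle.norm_coe]
  exact div_nonneg (by nlinarith [norm_nonneg w]) (sq_nonneg _)

theorem integral_poissonKernel_toCircle (hw : w ∈ ball (0 : ℂ) 1) :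
    ∫ x : UnitAddCircle, poissonKernel 0 w x.toCircle = 1 := by
  have hconst := (diffContOnCl_const (c := (1 : ℂ))).circleAverage_poissonKernel_smul hw
  rw [circleAverage_eq_integral_toCircle] at hconst
  simp only [Pi.smul_apply', Complex.real_smul, mul_one] at hconst
  exact Complex.ofReal_injective (integral_complex_ofReal.symm.trans hconst)

theorem integrable_continuous_mul {X R : Type*} [TopologicalSpace X] [CompactSpace X]
    [MeasurableSpace X] [OpensMeasurableSpace X] {μ : Measure X} [NormedRing R]
    [SecondCountableTopologyEither X R] {k f : X → R} (hk : Continuous k) (hf : Integrable f μ) :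
    Integrable (fun x => k x * f x) μ :=
  integrableOn_univ.1 <| hf.integrableOn.continuousOn_mul_of_subset hk.continuousOn isCompact_univ
    .univ Subset.rfl

/-- The Poisson integral at `w` of a boundary function, parametrized by `ℝ / ℤ`. -/
noncomputable def poissonIntegral (h : UnitAddCircle → ℝ) (w : ℂ) : ℝ :=
  ∫ x : UnitAddCircle, poissonKernel 0 w x.toCircle * h x

theorem poissonIntegral_const_mul (ε : ℝ) (h : UnitAddCircle → ℝ) (w : ℂ) :
    poissonIntegral (fun x => ε * h x) w = ε * poissonIntegral h w := by
  simp only [poissonIntegral, mul_left_comm _ ε, integral_const_mul]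

theorem poissonIntegral_le {A : ℝ} (hint : Integrable h) (hA : ∀ x, h x ≤ A)
    (hw : w ∈ ball (0 : ℂ) 1) : poissonIntegral h w ≤ A := by
  have hkernel := continuous_poissonKernel_toCircle hw
  calc poissonIntegral h w
      ≤ ∫ x : UnitAddCircle, poissonKernel 0 w x.toCircle * A :=
        integral_mono (integrable_continuous_mul hkernel hint)
          (integrable_continuous_mul hkernel (integrable_const A)) fun x =>
          mul_le_mul_of_nonneg_left (hA x) (poissonKernel_toCircle_nonneg hw x)
    _ = A := by rw [integral_mul_const, integral_poissonKernel_toCircle hw, one_mul]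

/-- The outer function in the unit disc whose modulus on the boundary is `exp h`. -/
noncomputable def outerFunction (h : UnitAddCircle → ℝ) (w : ℂ) : ℂ :=
  Complex.exp (∫ x : UnitAddCircle, herglotzRieszKernel 0 w x.toCircle * (h x : ℂ))

theorem norm_outerFunction (hint : Integrable h) (hw : w ∈ ball (0 : ℂ) 1) :
    ‖outerFunction h w‖ = rexp (poissonIntegral h w) := by
  have hprod := integrable_continuous_mul (continuous_herglotzRieszKernel_toCircle hw)
    (Complex.ofRealCLM.integrable_comp hint)
  rw [outerFunction, Complex.norm_exp]
  refine congrArg rexp ((Complex.reCLM.integral_comp_comm hprod).symm.trans ?_)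
  exact integral_congr_ae (.of_forall fun x => by
    simp [poissonKernel_eq_re_herglotzRieszKernel])

theorem differentiableOn_outerFunction (hint : Integrable h) :
    DifferentiableOn ℂ (outerFunction h) (ball 0 1) := by
  have hinj : Function.Injective fun x : UnitAddCircle => (x.toCircle : ℂ) :=
    Subtype.val_injective.comp (AddCircle.injective_toCircle one_ne_zero)
  let g : ℂ → ℂ :=
    Function.extend (fun x : UnitAddCircle => (x.toCircle : ℂ)) (fun x => (h x : ℂ)) 0
  have hg : ∀ x : UnitAddCircle, g x.toCircle = h x := hinj.extend_apply _ _
  have hint_ofReal : Integrable fun x => (h x : ℂ) := Complex.ofRealCLM.integrable_comp hint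
  have hg_int : CircleIntegrable g 0 1 :=
    circleIntegrable_of_integrable_toCircle (by simpa only [hg] using hint_ofReal)
  refine (differentiableOn_circleAverage_herglotzRieszKernel_smul hg_int).cexp.congr fun w _ => ?_
  simp only [outerFunction, circleAverage_eq_integral_toCircle, hg, smul_eq_mul]

theorem outerFunction_zero (h : UnitAddCircle → ℝ) :
    outerFunction h 0 = rexp (∫ x, h x) := by
  have hkernel : ∀ x : UnitAddCircle, herglotzRieszKernel 0 0 (x.toCircle : ℂ) = 1 := fun x => by
    simp [herglotzRieszKernel_def]
  simp only [outerFunction, hkernel, one_mul, integral_complex_ofReal, Complex.ofReal_exp]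

theorem exists_polynomial_norm_eval_toCircle_le {A r : ℝ} (hint : Integrable h)
    (hA : ∀ x, h x ≤ A) (hr₀ : 0 ≤ r) (hr₁ : r < 1) (n : ℕ) :
    ∃ p : ℂ[X], p.natDegree ≤ n ∧ p.eval 0 = rexp (∫ x, h x) ∧ ∀ x : UnitAddCircle,
      ‖p.eval (x.toCircle : ℂ)‖
        ≤ rexp (poissonIntegral h (r * x.toCircle)) + rexp A * r ^ (n + 1) / (1 - r) := by
  have hbound : ∀ w ∈ ball (0 : ℂ) 1, ‖outerFunction h w‖ ≤ rexp A := fun w hw => by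
    rw [norm_outerFunction hint hw]
    exact exp_le_exp.2 (poissonIntegral_le hint hA hw)
  obtain ⟨p, hdeg, hzero, hp⟩ :=
    exists_polynomial_norm_sub_eval_le (differentiableOn_outerFunction hint) hbound n
  refine ⟨p.comp (Polynomial.C (r : ℂ) * X), ?_, by simp [hzero, outerFunction_zero], fun x => ?_⟩
  · have hscale : (Polynomial.C (r : ℂ) * X).natDegree ≤ 1 :=
      (natDegree_C_mul_le _ _).trans natDegree_X_le
    exact natDegree_comp_le.trans ((Nat.mul_le_mul hdeg hscale).trans (mul_one n).le)
  · have hnorm : ‖(r * x.toCircle : ℂ)‖ = r := by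
      rw [norm_mul, Circle.norm_coe, mul_one, Complex.norm_of_nonneg hr₀]
    have hmem : (r * x.toCircle : ℂ) ∈ ball (0 : ℂ) 1 := by rwa [mem_ball_zero_iff, hnorm]
    have herror := hp _ hmem
    rw [sub_zero, hnorm, div_one] at herror
    rw [eval_comp, eval_mul, eval_C, eval_X, ← norm_outerFunction hint hmem]
    linarith [norm_le_norm_add_norm_sub' (p.eval (r * x.toCircle : ℂ))
      (outerFunction h (r * x.toCircle)), norm_sub_rev (p.eval (r * x.toCircle : ℂ))
      (outerFunction h (r * x.toCircle))]

end PoissonIntegral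

section PoissonKernelDecay

variable {x y : UnitAddCircle} {r η : ℝ}

theorem exists_coe_eq_and_abs_eq_norm (u : UnitAddCircle) : ∃ t : ℝ, t = u ∧ |t| = ‖u‖ := by
  induction u using QuotientAddGroup.induction_on with
  | H t => exact ⟨t - round t, by simp, UnitAddCircle.norm_eq.symm⟩

theorem four_mul_norm_le_norm_toCircle_sub_one (u : UnitAddCircle) :
    4 * ‖u‖ ≤ ‖(u.toCircle : ℂ) - 1‖ := by
  obtain ⟨t, rfl, ht⟩ := exists_coe_eq_and_abs_eq_norm u
  have hhalf : |t| ≤ 1 / 2 := by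
    simpa [ht] using AddCircle.norm_le_half_period (1 : ℝ) (x := (t : UnitAddCircle)) one_ne_zero
  have habs : |π * t| = π * |t| := by rw [abs_mul, abs_of_pos pi_pos]
  have hsin : 2 / π * |π * t| ≤ |sin (π * t)| :=
    mul_abs_le_abs_sin (by rw [habs]; nlinarith [pi_pos])
  have hchord : ‖(AddCircle.toCircle (t : UnitAddCircle) : ℂ) - 1‖ = 2 * |sin (π * t)| := by
    have hexp := Complex.norm_exp_I_mul_ofReal_sub_one (2 * π * t)
    rw [norm_mul, norm_ofNat, norm_eq_abs, show 2 * π * t / 2 = π * t by ring] at hexp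
    rw [coe_toCircle_coe, ← hexp, circleMap_zero, Complex.ofReal_one, one_mul, mul_comm]
  rw [hchord, ← ht]
  rw [habs, ← mul_assoc, div_mul_cancel₀ _ pi_ne_zero] at hsin
  linarith

theorem four_mul_dist_le_norm_toCircle_sub (x y : UnitAddCircle) :
    4 * dist x y ≤ ‖(x.toCircle : ℂ) - y.toCircle‖ := by
  have hfactor : (x.toCircle : ℂ) - y.toCircle = y.toCircle * ((x - y).toCircle - 1) := by
    rw [mul_sub, ← Circle.coe_mul, ← AddCircle.toCircle_add, add_sub_cancel, mul_one]
  rw [hfactor, norm_mul, Circle.norm_coe, one_mul, dist_eq_norm]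
  exact four_mul_norm_le_norm_toCircle_sub_one _

theorem two_mul_dist_le_norm_toCircle_sub (hr₀ : 0 ≤ r) (hr₁ : r ≤ 1) :
    2 * dist y x ≤ ‖(y.toCircle : ℂ) - r * x.toCircle‖ := by
  have hradial : ‖(r * x.toCircle : ℂ) - x.toCircle‖ = 1 - r := by
    rw [← sub_one_mul, norm_mul, Circle.norm_coe, mul_one, ← Complex.ofReal_one,
      ← Complex.ofReal_sub, Complex.norm_real, norm_eq_abs, abs_sub_comm, abs_of_nonneg]
    linarith
  have hgap := norm_sub_norm_le (y.toCircle : ℂ) (r * x.toCircle)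
  rw [norm_mul, Circle.norm_coe, Circle.norm_coe, mul_one, Complex.norm_of_nonneg hr₀] at hgap
  have htriangle := norm_sub_le_norm_sub_add_norm_sub (y.toCircle : ℂ) (r * x.toCircle) x.toCircle
  linarith [four_mul_dist_le_norm_toCircle_sub y x]

theorem poissonKernel_toCircle_le (hr₀ : 0 ≤ r) (hr₁ : r ≤ 1) (hη : 0 < η) (hxy : η ≤ dist y x) :
    poissonKernel 0 (r * x.toCircle) y.toCircle ≤ (1 - r) * (η ^ 2 + dist y x ^ 2)⁻¹ := by
  have hdist := two_mul_dist_le_norm_toCircle_sub (x := x) (y := y) hr₀ hr₁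
  have hsq : 2 * (η ^ 2 + dist y x ^ 2) ≤ ‖(y.toCircle : ℂ) - r * x.toCircle‖ ^ 2 := by
    nlinarith
  rw [poissonKernel_def, sub_zero, sub_zero, Circle.norm_coe, norm_mul, Circle.norm_coe, mul_one,
    Complex.norm_of_nonneg hr₀, ← div_eq_mul_inv]
  calc (1 ^ 2 - r ^ 2) / ‖(y.toCircle : ℂ) - r * x.toCircle‖ ^ 2
      ≤ (1 - r) * 2 / (2 * (η ^ 2 + dist y x ^ 2)) := by gcongr; nlinarith
    _ = (1 - r) / (η ^ 2 + dist y x ^ 2) := by field_simp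

theorem continuous_inv_sq_add_sq_dist (hη : 0 < η) (x : UnitAddCircle) :
    Continuous fun y => (η ^ 2 + dist y x ^ 2)⁻¹ :=
  .inv₀ (by fun_prop) fun y => by positivity

theorem integral_inv_sq_add_sq_dist_le (hη : 0 < η) (x : UnitAddCircle) :
    ∫ y, (η ^ 2 + dist y x ^ 2)⁻¹ ≤ π / η := by
  have hnorm : EqOn (fun t : ℝ => (η ^ 2 + ‖(t : UnitAddCircle)‖ ^ 2)⁻¹)
      (fun t => (η ^ 2 + t ^ 2)⁻¹) (uIcc (-(1 / 2)) (-(1 / 2) + 1)) := fun t ht => by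
    have habs : ‖(t : UnitAddCircle)‖ = |t| := by
      rw [AddCircle.norm_coe_eq_abs_iff _ one_ne_zero, abs_one, abs_le]
      rw [uIcc_of_le (by norm_num)] at ht
      exact ⟨ht.1, by linarith [ht.2]⟩
    simp only [habs, sq_abs]
  simp only [dist_eq_norm]
  rw [integral_sub_right_eq_self fun y : UnitAddCircle => (η ^ 2 + ‖y‖ ^ 2)⁻¹,
    ← UnitAddCircle.intervalIntegral_preimage (-(1 / 2)), intervalIntegral.integral_congr hnorm,
    integral_inv_sq_add_sq hη.ne', inv_mul_eq_div]
  gcongr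
  linarith [arctan_lt_pi_div_two ((-(1 / 2) + 1) / η), neg_pi_div_two_lt_arctan (-(1 / 2) / η)]

theorem poissonIntegral_le_add {h : UnitAddCircle → ℝ} {A B : ℝ} (hint : Integrable h)
    (hr₀ : 0 ≤ r) (hr₁ : r < 1) (hη : 0 < η) (hA₀ : 0 ≤ A) (hB₀ : 0 ≤ B)
    (hA : ∀ y, h y ≤ A) (hB : ∀ y ∈ ball x η, h y ≤ B) :
    poissonIntegral h (r * x.toCircle) ≤ B + A * (1 - r) * (π / η) := by
  have hw : (r * x.toCircle : ℂ) ∈ ball (0 : ℂ) 1 := by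
    rwa [mem_ball_zero_iff, norm_mul, Circle.norm_coe, mul_one, Complex.norm_of_nonneg hr₀]
  set P : UnitAddCircle → ℝ := fun y => poissonKernel 0 (r * x.toCircle) y.toCircle
  have hP : Continuous P := continuous_poissonKernel_toCircle hw
  have hP₀ : ∀ y, 0 ≤ P y := poissonKernel_toCircle_nonneg hw
  set T : UnitAddCircle → ℝ := fun y => (η ^ 2 + dist y x ^ 2)⁻¹
  have hT : Integrable T :=
    (continuous_inv_sq_add_sq_dist hη x).integrable_of_hasCompactSupport (.of_compactSpace _)
  have hsplit : ∀ y, P y * h y ≤ P y * B + A * (1 - r) * T y := fun y => by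
    rcases lt_or_ge (dist y x) η with hnear | hfar
    · have : 0 ≤ A * (1 - r) * T y :=
        mul_nonneg (mul_nonneg hA₀ (by linarith)) (by positivity)
      linarith [mul_le_mul_of_nonneg_left (hB y hnear) (hP₀ y)]
    · calc P y * h y ≤ P y * A := mul_le_mul_of_nonneg_left (hA y) (hP₀ y)
        _ ≤ (1 - r) * T y * A :=
          mul_le_mul_of_nonneg_right (poissonKernel_toCircle_le hr₀ hr₁.le hη hfar) hA₀
        _ ≤ P y * B + A * (1 - r) * T y := by linarith [mul_nonneg (hP₀ y) hB₀]
  have hPB : Integrable fun y => P y * B := integrable_continuous_mul hP (integrable_const B)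
  calc poissonIntegral h (r * x.toCircle)
      ≤ ∫ y, (P y * B + A * (1 - r) * T y) :=
        integral_mono (integrable_continuous_mul hP hint) (hPB.add (hT.const_mul _)) hsplit
    _ = B + A * (1 - r) * ∫ y, T y := by
        rw [integral_add hPB (hT.const_mul _), integral_mul_const, integral_const_mul,
          integral_poissonKernel_toCircle hw, one_mul]
    _ ≤ B + A * (1 - r) * (π / η) := by
        have : 0 ≤ 1 - r := by linarith
        gcongr
        exact integral_inv_sq_add_sq_dist_le hη x

end PoissonKernelDecay

section SzegoError

variable {ρ : Measure UnitAddCircle} {n : ℕ}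

theorem szegoError_le_sqrt_integral_of_coeff_eq_one {q : ℂ[X]} (hdeg : q.natDegree ≤ n)
    (hcoeff : q.coeff n = 1) :
    szegoError ρ n ≤ √(∫ x : UnitAddCircle, ‖q.eval (x.toCircle : ℂ)‖ ^ 2 ∂ρ) := by
  have heval : ∀ z : ℂ, q.eval z = (∑ k : Fin n, q.coeff k * z ^ (k : ℕ)) + z ^ n := fun z => by
    rw [eval_eq_sum_range' (Nat.lt_succ_of_le hdeg), Finset.sum_range_succ, hcoeff, one_mul,
      Fin.sum_univ_eq_sum_range fun k => q.coeff k * z ^ k]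
  simp only [heval]
  exact ciInf_le ⟨0, forall_mem_range.2 fun _ => sqrt_nonneg _⟩ fun k : Fin n => q.coeff k

theorem norm_eval_reflect_map_conj {p : ℂ[X]} (hdeg : p.natDegree ≤ n) (z : Circle) :
    ‖((p.map (starRingEnd ℂ)).reflect n).eval (z : ℂ)‖ = ‖p.eval (z : ℂ)‖ := by
  let _ : Invertible (z⁻¹ : ℂ) := invertibleOfNonzero (inv_ne_zero z.coe_ne_zero)
  have hreflect := eval₂_reflect_mul_pow (RingHom.id ℂ) (z⁻¹ : ℂ) n (p.map (starRingEnd ℂ))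
    (natDegree_map_le.trans hdeg)
  rw [invOf_eq_inv, inv_inv, ← eval, ← eval, ← Circle.coe_inv, Circle.coe_inv_eq_conj,
    eval_map_apply] at hreflect
  have hnorm := congrArg norm hreflect
  rwa [norm_mul, norm_pow, RCLike.norm_conj, RCLike.norm_conj, Circle.norm_coe, one_pow,
    mul_one] at hnorm

theorem szegoError_le_sqrt_integral_div {p : ℂ[X]} (hdeg : p.natDegree ≤ n)
    (hp : p.eval 0 ≠ 0) :
    szegoError ρ n
      ≤ √(∫ x : UnitAddCircle, ‖p.eval (x.toCircle : ℂ)‖ ^ 2 ∂ρ) / ‖p.eval 0‖ := by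
  set q := (p.map (starRingEnd ℂ)).reflect n with hq
  have hlead : q.coeff n = starRingEnd ℂ (p.eval 0) := by
    rw [hq, coeff_reflect, revAt_le le_rfl, Nat.sub_self, coeff_map, coeff_zero_eq_eval_zero]
  have hqdeg : q.natDegree ≤ n :=
    natDegree_reflect_le.trans (max_le le_rfl (natDegree_map_le.trans hdeg))
  have hlead_ne : q.coeff n ≠ 0 := by simpa [hlead] using hp
  have hmonic : (Polynomial.C (q.coeff n)⁻¹ * q).coeff n = 1 := by
    rw [coeff_C_mul, inv_mul_cancel₀ hlead_ne]
  refine (szegoError_le_sqrt_integral_of_coeff_eq_one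
    ((natDegree_C_mul_le _ _).trans hqdeg) hmonic).trans_eq ?_
  simp only [eval_mul, eval_C, norm_mul, mul_pow, hq, norm_eval_reflect_map_conj hdeg]
  rw [integral_const_mul, sqrt_mul (sq_nonneg _), sqrt_sq (norm_nonneg _), ← hq, hlead, norm_inv,
    RCLike.norm_conj, inv_mul_eq_div]

theorem ofReal_le_absLogSzegoError {b : ℝ} (h : szegoError ρ n ≤ rexp (-b)) :
    ENNReal.ofReal b ≤ absLogSzegoError ρ n := by
  rw [absLogSzegoError, ENNReal.log_ofReal]
  split_ifs with hzero
  · simp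
  · have hlog : Real.log (szegoError ρ n) ≤ -b := (log_le_iff_le_exp (not_le.1 hzero)).2 h
    rw [EReal.abs_def]
    exact ENNReal.ofReal_le_ofReal (le_abs'.2 (.inl hlog))

end SzegoError

section Truncation

variable {α : Type*} {H : α → ℝ≥0∞} {A : ℝ} {x : α}

/-- The truncation `min (H, A)` as a real-valued function. -/
noncomputable def truncation (H : α → ℝ≥0∞) (A : ℝ) (x : α) : ℝ :=
  (min (H x) (ENNReal.ofReal A)).toReal

theorem ofReal_truncation (H : α → ℝ≥0∞) (A : ℝ) (x : α) :
    ENNReal.ofReal (truncation H A x) = min (H x) (ENNReal.ofReal A) :=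
  ENNReal.ofReal_toReal (min_lt_of_right_lt ENNReal.ofReal_lt_top).ne

theorem truncation_nonneg (H : α → ℝ≥0∞) (A : ℝ) (x : α) :
    0 ≤ truncation H A x :=
  ENNReal.toReal_nonneg

theorem truncation_le (hA : 0 ≤ A) (x : α) : truncation H A x ≤ A :=
  ENNReal.toReal_le_of_le_ofReal hA (min_le_right _ _)

theorem truncation_of_ofReal_le (hA : 0 ≤ A) (hx : ENNReal.ofReal A ≤ H x) :
    truncation H A x = A := by
  rw [truncation, min_eq_right hx, ENNReal.toReal_ofReal hA]

theorem ofReal_exp_truncation_le (H : α → ℝ≥0∞) (A : ℝ) (x : α) :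
    ENNReal.ofReal (rexp (truncation H A x)) ≤ EReal.exp (H x : EReal) := by
  rw [← EReal.exp_coe]
  refine EReal.exp_monotone ?_
  rw [truncation, EReal.coe_ennreal_toReal (min_lt_of_right_lt ENNReal.ofReal_lt_top).ne]
  exact EReal.coe_ennreal_le_coe_ennreal_iff.2 (min_le_left _ _)

variable [MeasurableSpace α] {μ : Measure α} [IsFiniteMeasure μ]

theorem integrable_truncation (hH : Measurable H) (A : ℝ) : Integrable (truncation H A) μ := by
  refine .of_bound (hH.min measurable_const).ennreal_toReal.aestronglyMeasurable
    (ENNReal.ofReal A).toReal (.of_forall fun x => ?_)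
  rw [norm_of_nonneg (truncation_nonneg H A x)]
  exact ENNReal.toReal_mono ENNReal.ofReal_ne_top (min_le_right _ _)

theorem ofReal_integral_truncation (hH : Measurable H) (A : ℝ) :
    ENNReal.ofReal (∫ x, truncation H A x ∂μ) = ∫⁻ x, min (H x) (ENNReal.ofReal A) ∂μ := by
  rw [ofReal_integral_eq_lintegral_ofReal (integrable_truncation hH A)
    (.of_forall (truncation_nonneg H A))]
  simp only [ofReal_truncation]

theorem tendsto_integral_truncation_atTop (hH : Measurable H) (hH_top : ∫⁻ x, H x ∂μ = ∞) :
    Tendsto (fun A => ∫ x, truncation H A x ∂μ) atTop atTop := by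
  have hmono : Monotone fun A => ∫ x, truncation H A x ∂μ := fun A B hAB =>
    integral_mono (integrable_truncation hH A) (integrable_truncation hH B) fun x =>
      ENNReal.toReal_mono (min_lt_of_right_lt ENNReal.ofReal_lt_top).ne
        (min_le_min_left _ (ENNReal.ofReal_le_ofReal hAB))
  refine tendsto_atTop_of_monotone_of_subseq hmono (φ := ((↑) : ℕ → ℝ)) (l := atTop) ?_
  rw [← ENNReal.tendsto_ofReal_nhds_top, ← hH_top]
  simp only [Function.comp_apply, ofReal_integral_truncation hH]
  refine lintegral_tendsto_of_tendsto_of_monotone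
    (fun k => (hH.min measurable_const).aemeasurable)
    (.of_forall fun x i j hij => min_le_min_left _ (by gcongr)) (.of_forall fun x => ?_)
  have hlevel : Tendsto (fun k : ℕ => ENNReal.ofReal k) atTop (𝓝 ∞) :=
    ENNReal.tendsto_ofReal_atTop.comp tendsto_natCast_atTop_atTop
  simpa only [min_top_right] using tendsto_const_nhds (x := H x).min hlevel

theorem lintegral_distribution_le_integral_truncation {H : UnitAddCircle → ℝ≥0∞}
    (hH : Measurable H) (A : ℝ) :
    ∫⁻ a in Ioc 0 A, distribution H a ≤ ENNReal.ofReal (∫ x, truncation H A x) := by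
  have hint : Integrable (truncation H A) := integrable_truncation hH A
  rw [ofReal_integral_eq_lintegral_ofReal hint (.of_forall (truncation_nonneg H A)),
    lintegral_eq_lintegral_meas_lt _ (.of_forall (truncation_nonneg H A)) hint.aemeasurable,
    ← restrict_Ioo_eq_restrict_Ioc]
  refine (setLIntegral_mono' measurableSet_Ioo fun a ha => measure_mono fun x hx => ?_).trans
    (lintegral_mono_set Ioo_subset_Ioi_self)
  rw [mem_ofPred_eq, ← ENNReal.ofReal_lt_ofReal_iff_of_nonneg ha.1.le, ofReal_truncation]
  exact lt_min hx ((ENNReal.ofReal_lt_ofReal_iff_of_nonneg ha.1.le).2 ha.2)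

end Truncation

section SlowVariation

variable {H : UnitAddCircle → ℝ≥0∞} {A D t : ℝ}

/-- Quantitative slow variation of `H` below the level `A`: around every point with `H x < A`
there is a radius `η` on which `H` grows by at most the factor `D`, and which is not small compared
with the resolution `t`, namely `A t / η ≤ D H x`. -/
def SlowlyVariesBelow {α : Type*} [PseudoMetricSpace α] (D A t : ℝ) (H : α → ℝ≥0∞) : Prop :=
  ∀ x, H x < ENNReal.ofReal A → ∃ η > 0,
    (∀ y ∈ ball x η, H y ≤ ENNReal.ofReal D * H x) ∧
      ENNReal.ofReal (A * t) ≤ ENNReal.ofReal (D * η) * H x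

theorem SlowlyVariesBelow.exists_radius {α : Type*} [PseudoMetricSpace α] {H : α → ℝ≥0∞} {x : α}
    (hslow : SlowlyVariesBelow D A t H) (hD : 0 ≤ D) (hx : H x < ENNReal.ofReal A) :
    ∃ η > 0, (∀ y ∈ ball x η, truncation H A y ≤ D * truncation H A x) ∧
      A * t ≤ D * η * truncation H A x := by
  obtain ⟨η, hη, hnear, hscale⟩ := hslow x hx
  have hmul : ∀ b : ℝ, 0 ≤ b → ENNReal.ofReal b * H x = ENNReal.ofReal (b * truncation H A x) :=
    fun b hb => by rw [ENNReal.ofReal_mul hb, ofReal_truncation, min_eq_left hx.le]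
  have hnonneg := truncation_nonneg H A x
  refine ⟨η, hη, fun y hy => ?_, ?_⟩
  · rw [← ENNReal.ofReal_le_ofReal_iff (by positivity), ← hmul D hD, ofReal_truncation]
    exact (min_le_left _ _).trans (hnear y hy)
  · rwa [hmul _ (by positivity), ENNReal.ofReal_le_ofReal_iff (by positivity)] at hscale

/-- The factor by which smoothing at distance `(D + 1) t` from the circle can enlarge a truncation
that varies slowly in the sense of `SlowlyVariesBelow D A t`. -/
noncomputable def poissonConstant (D : ℝ) : ℝ := D + π * D * (D + 1)

theorem one_le_poissonConstant (hD : 1 ≤ D) : 1 ≤ poissonConstant D := by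
  have : 0 ≤ π * D * (D + 1) := by positivity
  rw [poissonConstant]
  linarith

theorem SlowlyVariesBelow.poissonIntegral_truncation_le (hslow : SlowlyVariesBelow D A t H)
    (hH : Measurable H) (hD : 1 ≤ D) (hA : 0 ≤ A) (ht : 0 < t) (htD : (D + 1) * t ≤ 1)
    (x : UnitAddCircle) :
    poissonIntegral (truncation H A) ((1 - (D + 1) * t : ℝ) * x.toCircle)
      ≤ poissonConstant D * truncation H A x := by
  have hr₀ : 0 ≤ 1 - (D + 1) * t := by linarith
  have hr₁ : 1 - (D + 1) * t < 1 := by nlinarith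
  have hint : Integrable (truncation H A) := integrable_truncation hH A
  rcases lt_or_ge (H x) (ENNReal.ofReal A) with hx | hx
  · obtain ⟨η, hη, hnear, hscale⟩ := hslow.exists_radius (by linarith) hx
    have hnonneg := truncation_nonneg H A x
    calc poissonIntegral (truncation H A) ((1 - (D + 1) * t : ℝ) * x.toCircle)
        ≤ D * truncation H A x + A * (1 - (1 - (D + 1) * t)) * (π / η) :=
          poissonIntegral_le_add hint hr₀ hr₁ hη hA (by positivity) (truncation_le hA) hnear
      _ = D * truncation H A x + π * (D + 1) * (A * t / η) := by ring
      _ ≤ D * truncation H A x + π * (D + 1) * (D * truncation H A x) := by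
          gcongr
          rw [div_le_iff₀ hη]
          linarith
      _ = poissonConstant D * truncation H A x := by rw [poissonConstant]; ring
  · have hw : ((1 - (D + 1) * t : ℝ) * x.toCircle : ℂ) ∈ ball (0 : ℂ) 1 := by
      rwa [mem_ball_zero_iff, norm_mul, Circle.norm_coe, mul_one, Complex.norm_of_nonneg hr₀]
    rw [truncation_of_ofReal_le hA hx]
    exact (poissonIntegral_le hint (truncation_le hA) hw).trans
      (le_mul_of_one_le_left hA (one_le_poissonConstant hD))

end SlowVariation

section MainEstimate

variable {H : UnitAddCircle → ℝ≥0∞} {ρ : Measure UnitAddCircle} {A D t ε : ℝ} {n : ℕ}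

theorem exp_mul_one_sub_pow_div_le_one {a δ : ℝ} (hδ₀ : 0 < δ) (hδ₁ : δ ≤ 1)
    (h : a + log (1 / δ) ≤ n * δ) : rexp a * (1 - δ) ^ (n + 1) / δ ≤ 1 := by
  have hpow : (1 - δ) ^ (n + 1) ≤ rexp (-(n * δ)) := calc
    (1 - δ) ^ (n + 1) ≤ (1 - δ) ^ n :=
      pow_le_pow_of_le_one (sub_nonneg.2 hδ₁) (by linarith) n.le_succ
    _ ≤ rexp (-δ) ^ n := pow_le_pow_left₀ (sub_nonneg.2 hδ₁) (one_sub_le_exp_neg δ) n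
    _ = rexp (-(n * δ)) := by rw [← exp_nat_mul]; ring_nf
  rw [div_le_one hδ₀]
  calc rexp a * (1 - δ) ^ (n + 1) ≤ rexp a * rexp (-(n * δ)) := by gcongr
    _ = rexp (a - n * δ) := by rw [← exp_add, sub_eq_add_neg]
    _ ≤ rexp (log δ) := by
        gcongr
        rw [one_div, log_inv] at h
        linarith
    _ = δ := exp_log hδ₀

/-- `t` is a resolution at which `min (H, A)` can be smoothed at bounded cost (slow variation),
while an outer function bounded by `exp A`, restricted to the circle of radius `1 - (D + 1) t`, is
within `1` of its Taylor polynomial of degree `n` (the conditions on `n` and `log (1 / t)`). -/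
structure IsSmoothingScale (D A t : ℝ) (n : ℕ) (H : UnitAddCircle → ℝ≥0∞) : Prop where
  pos : 0 < t
  add_one_mul_le_one : (D + 1) * t ≤ 1
  natCast_mul_eq : n * t = A
  log_le : log (1 / t) ≤ D * A
  slowlyVariesBelow : SlowlyVariesBelow D A t H

theorem IsSmoothingScale.nonneg (ht : IsSmoothingScale D A t n H) : 0 ≤ A :=
  ht.natCast_mul_eq ▸ mul_nonneg n.cast_nonneg ht.pos.le

theorem IsSmoothingScale.exists_polynomial_norm_eval_toCircle_le
    (ht : IsSmoothingScale D A t n H) (hH : Measurable H) (hD : 1 ≤ D)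
    (hε : 0 ≤ ε) (hεD : ε * poissonConstant D ≤ 1 / 2) :
    ∃ p : ℂ[X], p.natDegree ≤ n ∧ p.eval 0 = rexp (ε * ∫ x, truncation H A x) ∧
      ∀ x : UnitAddCircle, ‖p.eval (x.toCircle : ℂ)‖ ≤ 2 * rexp (truncation H A x / 2) := by
  have hA : 0 ≤ A := ht.nonneg
  obtain ⟨ht₀, htD, hnt, hlog, hslow⟩ := ht
  set δ := (D + 1) * t with hδ
  have hδ₀ : 0 < δ := by positivity
  have hε₁ : ε ≤ 1 := by nlinarith [one_le_poissonConstant hD]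
  have hbound : ∀ x, ε * truncation H A x ≤ A := fun x => by
    nlinarith [truncation_le hA (H := H) x, truncation_nonneg H A x]
  obtain ⟨p, hdeg, hzero, hp⟩ := SzegoMinimum.exists_polynomial_norm_eval_toCircle_le
    ((integrable_truncation hH A).const_mul ε) hbound (sub_nonneg.2 htD) (sub_lt_self 1 hδ₀) n
  refine ⟨p, hdeg, by rw [hzero, integral_const_mul], fun x => (hp x).trans ?_⟩
  have hmain : rexp (poissonIntegral (fun x => ε * truncation H A x) ((1 - δ : ℝ) * x.toCircle))
      ≤ rexp (truncation H A x / 2) := by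
    rw [poissonIntegral_const_mul]
    gcongr
    calc ε * poissonIntegral (truncation H A) ((1 - δ : ℝ) * x.toCircle)
        ≤ ε * (poissonConstant D * truncation H A x) := by
          gcongr
          exact hslow.poissonIntegral_truncation_le hH hD hA ht₀ htD x
      _ ≤ truncation H A x / 2 := by nlinarith [truncation_nonneg H A x]
  have herror : rexp A * (1 - δ) ^ (n + 1) / (1 - (1 - δ)) ≤ 1 := by
    rw [sub_sub_cancel]
    refine exp_mul_one_sub_pow_div_le_one hδ₀ htD ?_
    have : log (1 / δ) ≤ log (1 / t) := by gcongr; nlinarith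
    rw [hδ, mul_left_comm, hnt]
    linarith
  have hone : 1 ≤ rexp (truncation H A x / 2) :=
    one_le_exp (div_nonneg (truncation_nonneg H A x) zero_le_two)
  linarith

theorem sqrt_integral_sq_norm_le {α E : Type*} [MeasurableSpace α] {μ : Measure α}
    [NormedAddCommGroup E] {H : α → ℝ≥0∞} {f : α → E} {M : ℝ}
    (hexp : ∫⁻ x, EReal.exp (H x : EReal) ∂μ < ∞) (hM : 0 ≤ M)
    (hf : ∀ x, ‖f x‖ ≤ M * rexp (truncation H A x / 2)) :
    √(∫ x, ‖f x‖ ^ 2 ∂μ) ≤ M * √(∫⁻ x, EReal.exp (H x : EReal) ∂μ).toReal := by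
  have hsq : ∀ x, ENNReal.ofReal ‖‖f x‖ ^ 2‖
      ≤ ENNReal.ofReal (M ^ 2) * EReal.exp (H x : EReal) := fun x => by
    have : ‖f x‖ ^ 2 ≤ M ^ 2 * rexp (truncation H A x) := calc
      ‖f x‖ ^ 2 ≤ (M * rexp (truncation H A x / 2)) ^ 2 := by gcongr; exact hf x
      _ = M ^ 2 * rexp (truncation H A x) := by rw [mul_pow, ← exp_nat_mul]; ring_nf
    rw [norm_pow, norm_norm]
    refine (ENNReal.ofReal_le_ofReal this).trans ?_
    rw [ENNReal.ofReal_mul (sq_nonneg M)]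
    gcongr
    exact ofReal_exp_truncation_le H A x
  have hintegral : ∫ x, ‖f x‖ ^ 2 ∂μ ≤ M ^ 2 * (∫⁻ x, EReal.exp (H x : EReal) ∂μ).toReal := calc
    ∫ x, ‖f x‖ ^ 2 ∂μ ≤ (∫⁻ x, ENNReal.ofReal ‖‖f x‖ ^ 2‖ ∂μ).toReal :=
      (le_norm_self _).trans (norm_integral_le_lintegral_norm _)
    _ ≤ (ENNReal.ofReal (M ^ 2) * ∫⁻ x, EReal.exp (H x : EReal) ∂μ).toReal := by
      rw [← lintegral_const_mul' _ _ ENNReal.ofReal_ne_top]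
      refine ENNReal.toReal_mono ?_ (lintegral_mono hsq)
      rw [lintegral_const_mul' _ _ ENNReal.ofReal_ne_top]
      exact ENNReal.mul_ne_top ENNReal.ofReal_ne_top hexp.ne
    _ = M ^ 2 * (∫⁻ x, EReal.exp (H x : EReal) ∂μ).toReal := by
      rw [ENNReal.toReal_mul, ENNReal.toReal_ofReal (sq_nonneg M)]
  calc √(∫ x, ‖f x‖ ^ 2 ∂μ) ≤ √(M ^ 2 * (∫⁻ x, EReal.exp (H x : EReal) ∂μ).toReal) :=
        sqrt_le_sqrt hintegral
    _ = M * √(∫⁻ x, EReal.exp (H x : EReal) ∂μ).toReal := by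
        rw [sqrt_mul (sq_nonneg M), sqrt_sq hM]

theorem IsSmoothingScale.szegoError_le (ht : IsSmoothingScale D A t n H) (hH : Measurable H)
    (hexp : ∫⁻ x, EReal.exp (H x : EReal) ∂ρ < ∞) (hD : 1 ≤ D) (hε : 0 ≤ ε)
    (hεD : ε * poissonConstant D ≤ 1 / 2) :
    szegoError ρ n ≤ 2 * √(∫⁻ x, EReal.exp (H x : EReal) ∂ρ).toReal /
      rexp (ε * ∫ x, truncation H A x) := by
  obtain ⟨p, hdeg, hzero, hp⟩ :=
    ht.exists_polynomial_norm_eval_toCircle_le hH hD hε hεD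
  have hnorm : ‖p.eval 0‖ = rexp (ε * ∫ x, truncation H A x) := by
    rw [hzero, Complex.norm_of_nonneg (exp_nonneg _)]
  have hne : p.eval 0 ≠ 0 := norm_ne_zero_iff.1 (hnorm ▸ exp_ne_zero _)
  refine (szegoError_le_sqrt_integral_div hdeg hne).trans ?_
  rw [hnorm]
  gcongr
  exact sqrt_integral_sq_norm_le hexp zero_le_two hp

theorem exists_eventually_le_absLogSzegoError (hD : 1 ≤ D) :
    ∃ c > 0, ∀ (H : UnitAddCircle → ℝ≥0∞) (ρ : Measure UnitAddCircle), Measurable H →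
      ∫⁻ x, H x = ∞ → ∫⁻ x, EReal.exp (H x : EReal) ∂ρ < ∞ →
      ∀ᶠ A in atTop, ∀ t n, IsSmoothingScale D A t n H →
        ENNReal.ofReal c * ∫⁻ a in Ioc 0 A, distribution H a ≤ absLogSzegoError ρ n := by
  have hK : 0 < poissonConstant D := one_pos.trans_le (one_le_poissonConstant hD)
  obtain ⟨ε, hε, hεD⟩ : ∃ ε > 0, ε * poissonConstant D ≤ 1 / 2 :=
    ⟨1 / (2 * poissonConstant D), by positivity, le_of_eq (by field_simp)⟩
  refine ⟨ε / 2, half_pos hε, fun H ρ hH hH_top hexp => ?_⟩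
  set S := 2 * √(∫⁻ x, EReal.exp (H x : EReal) ∂ρ).toReal
  have hlarge : ∀ᶠ A in atTop, S ≤ rexp (ε / 2 * ∫ x, truncation H A x) :=
    (tendsto_exp_atTop.comp ((tendsto_integral_truncation_atTop hH hH_top).const_mul_atTop
      (half_pos hε))).eventually_ge_atTop S
  filter_upwards [hlarge] with A hS t n ht
  have herror : szegoError ρ n ≤ rexp (-(ε / 2 * ∫ x, truncation H A x)) := calc
    szegoError ρ n ≤ S / rexp (ε * ∫ x, truncation H A x) :=
      ht.szegoError_le hH hexp hD hε.le hεD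
    _ ≤ rexp (ε / 2 * ∫ x, truncation H A x) / rexp (ε * ∫ x, truncation H A x) := by gcongr
    _ = rexp (-(ε / 2 * ∫ x, truncation H A x)) := by rw [← exp_sub]; ring_nf
  calc ENNReal.ofReal (ε / 2) * ∫⁻ a in Ioc 0 A, distribution H a
      ≤ ENNReal.ofReal (ε / 2) * ENNReal.ofReal (∫ x, truncation H A x) := by
        gcongr
        exact lintegral_distribution_le_integral_truncation hH A
    _ = ENNReal.ofReal (ε / 2 * ∫ x, truncation H A x) := (ENNReal.ofReal_mul (by positivity)).symm
    _ ≤ absLogSzegoError ρ n := ofReal_le_absLogSzegoError herror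

end MainEstimate

section Profile

variable {φ : ℝ → ℝ≥0∞} {H : UnitAddCircle → ℝ≥0∞} {A C D s t : ℝ}

theorem IsProfile.lt_top (hφ : IsProfile φ) (hs : s ∈ Ioc 0 (1 / 2)) : φ s < ∞ :=
  hφ.map_zero ▸ hφ.strictAntiOn ⟨le_rfl, by norm_num⟩ (Ioc_subset_Icc_self hs) hs.1

theorem IsProfile.exists_eq (hφ : IsProfile φ) {v : ℝ≥0∞} (hle : φ (1 / 2) ≤ v) (hv : v < ∞) :
    ∃ s ∈ Ioc 0 (1 / 2), φ s = v := by
  obtain ⟨s, hs, hsv⟩ := intermediate_value_Icc' one_half_pos.le hφ.continuousOn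
    ⟨hle, hφ.map_zero ▸ le_top⟩
  refine ⟨s, ⟨hs.1.lt_of_ne ?_, hs.2⟩, hsv⟩
  rintro rfl
  exact hv.ne (hsv.symm.trans hφ.map_zero)

theorem IsSubordinate.exists_radius (hH : IsSubordinate H φ) (hφ : IsProfile φ) {x : UnitAddCircle}
    (hx : H x < ∞) :
    ∃ s ∈ Ioc 0 (1 / 2), φ s = H x ∧ ∀ y ∈ ball x s, H y ≤ φ (s - dist y x) := by
  obtain ⟨s, hs, hsx⟩ := hφ.exists_eq (hH.le_inf.trans (iInf_le H x)) hx
  refine ⟨s, hs, hsx, fun y hy => ?_⟩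
  obtain ⟨τ, rfl, hτ⟩ := exists_coe_eq_and_abs_eq_norm x
  obtain ⟨u, hu, hu_abs⟩ := exists_coe_eq_and_abs_eq_norm (y - τ)
  obtain rfl : ((τ + u : ℝ) : UnitAddCircle) = y := by rw [AddCircle.coe_add, hu, add_sub_cancel]
  have hτ_mem : τ ∈ Icc (-(1 / 2)) (1 / 2) := by
    simpa [← abs_le, hτ] using
      AddCircle.norm_le_half_period (1 : ℝ) (x := (τ : UnitAddCircle)) one_ne_zero
  rw [mem_ball, dist_eq_norm, ← hu_abs] at hy
  rw [dist_eq_norm, ← hu_abs]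
  rcases le_total 0 u with hu₀ | hu₀
  · rw [abs_of_nonneg hu₀] at hy ⊢
    refine (hH.right τ hτ_mem s (Ioc_subset_Icc_self hs) hsx (τ + u) ?_ ?_).trans_eq ?_
    · linarith
    · linarith
    · ring_nf
  · rw [abs_of_nonpos hu₀] at hy ⊢
    refine (hH.left τ hτ_mem s (Ioc_subset_Icc_self hs) hsx (τ + u) ?_ ?_).trans_eq ?_
    · linarith
    · linarith
    · ring_nf

theorem IsSubordinate.slowlyVariesBelow (hH : IsSubordinate H φ) (hφ : IsProfile φ)
    (hdouble : ∀ s ∈ Ioc 0 (1 / 2), φ (s / 2) ≤ ENNReal.ofReal D * φ s)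
    (hscale : ∀ s ∈ Ioc 0 (1 / 2), φ s < ENNReal.ofReal A →
      ENNReal.ofReal (A * t) ≤ ENNReal.ofReal (D * (s / 2)) * φ s) :
    SlowlyVariesBelow D A t H := fun x hx => by
  obtain ⟨s, hs, hsx, hnear⟩ := hH.exists_radius hφ (hx.trans ENNReal.ofReal_lt_top)
  refine ⟨s / 2, half_pos hs.1, fun y hy => ?_, hsx ▸ hscale s hs (hsx ▸ hx)⟩
  have hs₀ : 0 < s := hs.1
  have hdist : dist y x < s / 2 := hy
  calc H y ≤ φ (s - dist y x) := hnear y (ball_subset_ball (half_le_self hs₀.le) hy)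
    _ ≤ φ (s / 2) := hφ.strictAntiOn.antitoneOn ⟨by linarith, by linarith [hs.2]⟩
        ⟨by linarith, by linarith [hs.2, dist_nonneg (x := y) (y := x)]⟩ (by linarith)
    _ ≤ ENNReal.ofReal D * φ s := hdouble s hs
    _ = ENNReal.ofReal D * H x := by rw [hsx]

theorem Reg1.doubling (hreg : Reg1 C φ) (hs : s ∈ Ioc 0 (1 / 2)) :
    φ (s / 2) ≤ ENNReal.ofReal 2 * φ s := by
  have hhalf : 0 < s / 2 := half_pos hs.1
  have hmono : ENNReal.ofReal (s / 2) * φ (s / 2) ≤ ENNReal.ofReal s * φ s :=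
    hreg.mono ⟨hhalf, by linarith [hs.2]⟩ hs (by linarith)
  rw [← div_mul_cancel₀ s two_ne_zero, ENNReal.ofReal_mul hhalf.le, mul_assoc,
    div_mul_cancel₀ s two_ne_zero] at hmono
  exact (ENNReal.mul_le_mul_iff_right (ENNReal.ofReal_pos.2 hhalf).ne' ENNReal.ofReal_ne_top).1
    hmono

theorem Reg1.slowlyVariesBelow (hreg : Reg1 C φ) (hφ : IsProfile φ) (hH : IsSubordinate H φ)
    (hD : 2 ≤ D) (ht : t ∈ Ioc 0 (1 / 2)) (htA : φ t = ENNReal.ofReal A) :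
    SlowlyVariesBelow D A t H := by
  refine hH.slowlyVariesBelow hφ (fun s hs => (hreg.doubling hs).trans (by gcongr))
    fun s hs hsA => ?_
  have hts : t < s := (hφ.strictAntiOn.lt_iff_gt (Ioc_subset_Icc_self hs)
    (Ioc_subset_Icc_self ht)).1 (htA ▸ hsA)
  calc ENNReal.ofReal (A * t) = ENNReal.ofReal t * φ t := by
        rw [htA, mul_comm, ENNReal.ofReal_mul ht.1.le]
    _ ≤ ENNReal.ofReal s * φ s := hreg.mono ht hs hts.le
    _ ≤ ENNReal.ofReal (D * (s / 2)) * φ s := by gcongr; nlinarith [hs.1]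

theorem Reg2.slowlyVariesBelow (hreg : Reg2 C φ) (hφ : IsProfile φ) (hH : IsSubordinate H φ)
    (hC : 0 ≤ C) (hD : 2 * C ≤ D) (hA : A ≠ 0) : SlowlyVariesBelow D A (1 / A) H := by
  refine hH.slowlyVariesBelow hφ (fun s hs => (hreg.doubling s hs).trans (by gcongr; linarith))
    fun s hs _ => ?_
  have hs₀ : 0 < s := hs.1
  calc ENNReal.ofReal (A * (1 / A)) = ENNReal.ofReal s * ENNReal.ofReal (1 / s) := by
        rw [← ENNReal.ofReal_mul hs₀.le, mul_one_div_cancel hA, mul_one_div_cancel hs₀.ne']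
    _ ≤ ENNReal.ofReal s * (ENNReal.ofReal C * φ s) := by gcongr; exact hreg.inv_le s hs
    _ = ENNReal.ofReal (s * C) * φ s := by rw [← mul_assoc, ENNReal.ofReal_mul hs₀.le]
    _ ≤ ENNReal.ofReal (D * (s / 2)) * φ s := by gcongr ENNReal.ofReal ?_ * _; nlinarith

end Profile

section LevelEquation

variable {φ : ℝ → ℝ≥0∞} {H : UnitAddCircle → ℝ≥0∞} {A B C D : ℝ} {n : ℕ}

theorem SolvesLevelEquation.exists_mem_Ioc (hA : SolvesLevelEquation φ n A) (hφ : IsProfile φ) :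
    ∃ t ∈ Ioc 0 (1 / 2), φ t = ENNReal.ofReal A ∧ n * t = A := by
  obtain ⟨-, t, ht, htA, hnt⟩ := hA
  refine ⟨t, ⟨ht.1.lt_of_ne ?_, ht.2⟩, htA, hnt⟩
  rintro rfl
  exact ENNReal.ofReal_ne_top (htA.symm.trans hφ.map_zero)

theorem SolvesLevelEquation.le (hφ : IsProfile φ) (hA : SolvesLevelEquation φ n A)
    (hB : SolvesLevelEquation φ n B) : A ≤ B := by
  obtain ⟨-, s, hs, hsA, rfl⟩ := hA
  obtain ⟨hB₀, t, ht, htB, rfl⟩ := hB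
  by_contra! hlt
  have hst : s < t := by
    rw [← hφ.strictAntiOn.lt_iff_gt ht hs, hsA, htB]
    exact (ENNReal.ofReal_lt_ofReal_iff_of_nonneg hB₀).2 hlt
  exact hlt.not_ge (by gcongr)

theorem IsProfile.eventually_exists_solvesLevelEquation (hφ : IsProfile φ) :
    ∀ᶠ n : ℕ in atTop, ∃ A, SolvesLevelEquation φ n A := by
  have hfin : φ (1 / 2) < ∞ := hφ.lt_top ⟨one_half_pos, le_rfl⟩
  have hlarge : ∀ᶠ n : ℕ in atTop, (φ (1 / 2)).toReal ≤ n * (1 / 2) :=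
    (tendsto_natCast_atTop_atTop.atTop_mul_const one_half_pos).eventually_ge_atTop _
  filter_upwards [hlarge] with n hn
  obtain ⟨t, ht, htn⟩ := isPreconnected_Icc.intermediate_value₂
    (left_mem_Icc.2 one_half_pos.le) (right_mem_Icc.2 one_half_pos.le)
    (f := fun t : ℝ => ENNReal.ofReal (n * t))
    (ENNReal.continuous_ofReal.comp (by fun_prop)).continuousOn hφ.continuousOn
    (hφ.map_zero ▸ le_top) ((ENNReal.le_ofReal_iff_toReal_le hfin.ne (by positivity)).2 hn)
  exact ⟨n * t, mul_nonneg n.cast_nonneg ht.1, t, ht, htn.symm, rfl⟩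

theorem IsProfile.eventually_existsUnique_solvesLevelEquation (hφ : IsProfile φ) :
    ∀ᶠ n : ℕ in atTop, ∃! A, SolvesLevelEquation φ n A := by
  filter_upwards [hφ.eventually_exists_solvesLevelEquation] with n ⟨A, hA⟩
  exact ⟨A, hA, fun B hB => (hB.le hφ hA).antisymm (hA.le hφ hB)⟩

theorem IsProfile.eventually_forall_solvesLevelEquation (hφ : IsProfile φ) {P : ℝ → Prop}
    (hP : ∀ᶠ A in atTop, P A) : ∀ᶠ n : ℕ in atTop, ∀ A, SolvesLevelEquation φ n A → P A := by
  obtain ⟨B, hB⟩ := eventually_atTop.1 hP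
  obtain ⟨s, hs, hsB⟩ := hφ.exists_eq (le_max_left _ (ENNReal.ofReal B))
    (max_lt (hφ.lt_top ⟨one_half_pos, le_rfl⟩) ENNReal.ofReal_lt_top)
  have hlarge : ∀ᶠ n : ℕ in atTop, B ≤ n * s :=
    (tendsto_natCast_atTop_atTop.atTop_mul_const hs.1).eventually_ge_atTop B
  filter_upwards [hlarge] with n hn
  rintro A ⟨-, t, ht, htA, hnt⟩
  refine hB A (le_of_not_gt fun hlt => ?_)
  have hst : s ≤ t := by
    rw [← hφ.strictAntiOn.le_iff_ge ht (Ioc_subset_Icc_self hs), hsB, htA]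
    exact le_max_of_le_right (by gcongr)
  have : (n : ℝ) * s ≤ n * t := by gcongr
  linarith

theorem IsProfile.eventually_forall_eq_ofReal_le (hφ : IsProfile φ) {δ : ℝ}
    (hδ : δ ∈ Ioc 0 (1 / 2)) :
    ∀ᶠ A in atTop, ∀ t ∈ Icc 0 (1 / 2), φ t = ENNReal.ofReal A → t ≤ δ := by
  filter_upwards [eventually_ge_atTop (φ δ).toReal] with A hA t ht htA
  rw [← hφ.strictAntiOn.le_iff_ge (Ioc_subset_Icc_self hδ) ht, htA]
  exact (ENNReal.le_ofReal_iff_toReal_le (hφ.lt_top hδ).ne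
    (ENNReal.toReal_nonneg.trans hA)).2 hA

theorem Reg1.eventually_exists_isSmoothingScale (hreg : Reg1 C φ) (hφ : IsProfile φ)
    (hH : IsSubordinate H φ) (hC : 0 ≤ C) (hD : 2 ≤ D) (hCD : C ≤ D) :
    ∀ᶠ n : ℕ in atTop, ∀ A, SolvesLevelEquation φ n A → ∃ t, IsSmoothingScale D A t n H := by
  have hδ : 1 / (D + 1) ∈ Ioc (0 : ℝ) (1 / 2) := ⟨by positivity, by gcongr; linarith⟩
  filter_upwards [hφ.eventually_forall_solvesLevelEquation
    (hφ.eventually_forall_eq_ofReal_le hδ)] with n hsmall A hA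
  obtain ⟨t, ht, htA, hnt⟩ := hA.exists_mem_Ioc hφ
  have htD : t ≤ 1 / (D + 1) := hsmall A hA t (Ioc_subset_Icc_self ht) htA
  refine ⟨t, ht.1, ?_, hnt, ?_, hreg.slowlyVariesBelow hφ hH hD ht htA⟩
  · rwa [le_div_iff₀ (by positivity), mul_comm] at htD
  · have hA₀ : 0 ≤ A := hA.1
    have hlog := hreg.log_le t ht
    rw [htA, ← ENNReal.ofReal_mul hC, ENNReal.ofReal_le_ofReal_iff (by positivity)] at hlog
    exact hlog.trans (by gcongr)

theorem tendsto_sqrt_natCast_atTop : Tendsto (fun n : ℕ => √n) atTop atTop :=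
  tendsto_sqrt_atTop.comp tendsto_natCast_atTop_atTop

theorem Reg2.eventually_exists_isSmoothingScale (hreg : Reg2 C φ) (hφ : IsProfile φ)
    (hH : IsSubordinate H φ) (hC : 0 ≤ C) (hD : 1 ≤ D) (hCD : 2 * C ≤ D) :
    ∀ᶠ n : ℕ in atTop, ∃ t, IsSmoothingScale D √n t n H := by
  filter_upwards [tendsto_sqrt_natCast_atTop.eventually_ge_atTop (D + 1)] with n hn
  have hsqrt : 0 < √(n : ℝ) := by linarith
  refine ⟨1 / √n, by positivity, ?_, by rw [mul_one_div, div_sqrt], ?_,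
    hreg.slowlyVariesBelow hφ hH hC hCD hsqrt.ne'⟩
  · rwa [mul_one_div, div_le_one hsqrt]
  · rw [one_div_one_div]
    exact (log_le_self hsqrt.le).trans (le_mul_of_one_le_left hsqrt.le hD)

end LevelEquation

end SzegoMinimum

theorem mainTheorem3 (C : ℝ) (hC : 0 < C) :
    ∃ c : ℝ, 0 < c ∧
      ∀ (φ : ℝ → ℝ≥0∞) (H : UnitAddCircle → ℝ≥0∞) (ρ : Measure UnitAddCircle)
        [IsFiniteMeasure ρ],
        SzegoMinimum.IsProfile φ →
        Measurable H →
        (∫⁻ x, H x) = ∞ →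
        SzegoMinimum.IsSubordinate H φ →
        (∫⁻ x, EReal.exp (H x : EReal) ∂ρ) < ∞ →
        (SzegoMinimum.Reg1 C φ →
          ∀ᶠ n : ℕ in atTop,
            (∃! A : ℝ, SzegoMinimum.SolvesLevelEquation φ n A) ∧
            ∀ A : ℝ, SzegoMinimum.SolvesLevelEquation φ n A →
              ENNReal.ofReal c * (∫⁻ a in Ioc 0 A, SzegoMinimum.distribution H a)
                ≤ SzegoMinimum.absLogSzegoError ρ n) ∧
        (SzegoMinimum.Reg2 C φ →
          ∀ᶠ n : ℕ in atTop,
            ENNReal.ofReal c *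
                (∫⁻ a in Ioc 0 (Real.sqrt n), SzegoMinimum.distribution H a)
              ≤ SzegoMinimum.absLogSzegoError ρ n) := by
  have hD : 2 ≤ 2 * max C 1 := by linarith [le_max_right C 1]
  have hCD : 2 * C ≤ 2 * max C 1 := by linarith [le_max_left C 1]
  obtain ⟨c, hc, hmain⟩ :=
    SzegoMinimum.exists_eventually_le_absLogSzegoError (one_le_two.trans hD)
  refine ⟨c, hc, fun φ H ρ _ hφ hH hH_top hsub hexp => ⟨fun hreg => ?_, fun hreg => ?_⟩⟩
  · filter_upwards [hφ.eventually_existsUnique_solvesLevelEquation,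
      hφ.eventually_forall_solvesLevelEquation (hmain H ρ hH hH_top hexp),
      hreg.eventually_exists_isSmoothingScale hφ hsub hC.le hD (by linarith)]
      with n hunique hestimate hscale
    refine ⟨hunique, fun A hA => ?_⟩
    obtain ⟨t, ht⟩ := hscale A hA
    exact hestimate A hA t n ht
  · filter_upwards [SzegoMinimum.tendsto_sqrt_natCast_atTop.eventually (hmain H ρ hH hH_top hexp),
      hreg.eventually_exists_isSmoothingScale hφ hsub hC.le (one_le_two.trans hD) hCD]
      with n hestimate ⟨t, ht⟩
    exact hestimate t n ht
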